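/- Let $\mathbb{N}=\{1,2,3,\ldots\}$. For $k\in\mathbb{N}$ let $\mathscr{C}_k\subseteq\mathbb{R}$ be the set of real numbers that are not algebraic of degree $\le k$, and for a real function $\psi$ on $\mathbb{R}_{>0}$ let $$\mathscr{K}_k(\psi)=\Big\{\zeta\in\mathscr{C}_k:\ \max_{1\le i\le k}|\zeta^i q-p_i|\le\psi(q)\ \text{ for infinitely many } (q,p_1,\ldots,p_k)\in\mathbb{N}\times\mathbb{Z}^k\Big\};$$ let $\mathscr{K}_k^*(\psi)$ be defined in the same way, counting only vectors $(q,p_1,\ldots,p_k)$ whose entries have greatest common divisor $1$. A function $\Psi:\mathbb{R}_{>0}\to\mathbb{R}_{>0}$ is called admissible of degree $k$ if $$\text{(A0.}k)\quad \Psi(x)=o(x^{-2k+1})\ \ (x\to\infty),\qquad\qquad \text{(B0.}k)\quad \frac{\Psi(x)}{\Psi(y)}\ge\Big(\frac{y}{x}\Big)^{k-1}\ \text{ for all large } x\le y,$$ and strictly admissible if it is admissible of degree $k$ for every $k\ge1$. For $j\ge 1$ put $$\Psi_j(x)=\Psi(x^{1/j})\,x^{(j-1)/j},\qquad \mathscr{K}^j=\mathscr{K}_j(\Psi_j)\setminus\bigcup_{c<1}\mathscr{K}_j(c\Psi_j),\qquad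 \mathscr{K}^{*j}=\mathscr{K}_j^*(\Psi_j)\setminus\bigcup_{c<1}\mathscr{K}_j^*(c\Psi_j),$$ so that $\Psi_1=\Psi$. Theorem. (1) Let $k\ge1$ and let $\Psi$ be admissible of degree $k$. Then for $1\le j\le k$ the function $\Psi_j$ satisfies $\Psi_j(x)=o(x^{-1})$ as $x\to\infty$, it is non-increasing for all large arguments, and $(-1/2,1/2)\cap\mathscr{K}^j=(-1/2,1/2)\cap\mathscr{K}^1$. (2) If $\Psi$ is strictly admissible, then for every $j\ge1$ the function $\Psi_j$ is strictly admissible and $(-1/2,1/2)\cap\mathscr{K}^j=(-1/2,1/2)\cap\mathscr{K}^1$. (3) Let $k\ge 1$ and let $\Psi:\mathbb{R}_{>0}\to\mathbb{R}_{>0}$ satisfy (A0.$k$) (but not necessarily (B0.$k$)). Then for $1\le j\le k$ we have $\Psi_j(x)=o(x^{-1})$ as $x\to\infty$ and $(-1/2,1/2)\cap\mathscr{K}^{*j}=(-1/2,1/2)\cap\mathscr{K}^{*1}$. (4) If $\Psi:\mathbb{R}_{>0}\to\mathbb{R}_{>0}$ satisfies (A0.$m$) for every $m\ge1$, then for every $j\ge1$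 the function $\Psi_j$ satisfies (A0.$m$) for every $m\ge1$, and $(-1/2,1/2)\cap\mathscr{K}^{*j}=(-1/2,1/2)\cap\mathscr{K}^{*1}$. -/

import Mathlib

noncomputable section

/-- Real numbers that are not algebraic (over `ℚ`) of degree `≤ k`. -/
def NotAlgOfDegLE (k : ℕ) : Set ℝ :=
  {ζ | ¬ (IsAlgebraic ℚ ζ ∧ (minpoly ℚ ζ).natDegree ≤ k)}

/-- The vectors `(q, p₁, …, p_k)` with `q ≥ 1` an integer and `p_i` integers such that
`max_{1 ≤ i ≤ k} |ζ ^ i q - p_i| ≤ ψ q`; the entry `p_i` is stored at the index `i - 1` of `Fin k`. -/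
def approxVectors (k : ℕ) (ψ : ℝ → ℝ) (ζ : ℝ) : Set (ℕ × (Fin k → ℤ)) :=
  {v | 1 ≤ v.1 ∧ ∀ i : Fin k, |ζ ^ ((i : ℕ) + 1) * (v.1 : ℝ) - (v.2 i : ℝ)| ≤ ψ (v.1 : ℝ)}

/-- The vector `(q, p₁, …, p_k)` is relatively prime: the gcd of all its entries is `1`. -/
def IsRelPrimeVector {k : ℕ} (v : ℕ × (Fin k → ℤ)) : Prop :=
  Nat.gcd v.1 (Finset.univ.gcd fun i => (v.2 i).natAbs) = 1

/-- The set `𝒦_k(ψ)`. -/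
def approxSet (k : ℕ) (ψ : ℝ → ℝ) : Set ℝ :=
  {ζ | ζ ∈ NotAlgOfDegLE k ∧ (approxVectors k ψ ζ).Infinite}

/-- The set `𝒦_k^*(ψ)`: only relatively prime vectors are counted. -/
def approxSetStar (k : ℕ) (ψ : ℝ → ℝ) : Set ℝ :=
  {ζ | ζ ∈ NotAlgOfDegLE k ∧ {v | v ∈ approxVectors k ψ ζ ∧ IsRelPrimeVector v}.Infinite}

/-- The numbers of exact order `ψ`: `𝒦_k(ψ) ∖ ⋃_{c < 1} 𝒦_k(c ψ)`. -/
def exactSet (k : ℕ) (ψ : ℝ → ℝ) : Set ℝ :=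
  approxSet k ψ \ ⋃ (c : ℝ) (_ : c < 1), approxSet k (fun x => c * ψ x)

/-- The numbers of exact order `ψ` with respect to relatively prime vectors:
`𝒦_k^*(ψ) ∖ ⋃_{c < 1} 𝒦_k^*(c ψ)`. -/
def exactSetStar (k : ℕ) (ψ : ℝ → ℝ) : Set ℝ :=
  approxSetStar k ψ \ ⋃ (c : ℝ) (_ : c < 1), approxSetStar k (fun x => c * ψ x)

/-- `Ψ(x) = o(x ^ (-2k + 1))` as `x → ∞`. -/
def DecayOfDegree (k : ℕ) (Ψ : ℝ → ℝ) : Prop :=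
  Asymptotics.IsLittleO Filter.atTop Ψ (fun x : ℝ => x ^ (-2 * (k : ℝ) + 1))

/-- `Ψ(x) / Ψ(y) ≥ (y / x) ^ (k - 1)` for all large `x ≤ y`. -/
def RatioOfDegree (k : ℕ) (Ψ : ℝ → ℝ) : Prop :=
  ∃ x₀ : ℝ, 0 < x₀ ∧ ∀ x y : ℝ, x₀ ≤ x → x ≤ y → (y / x) ^ ((k : ℝ) - 1) ≤ Ψ x / Ψ y

/-- A function with positive values on the positive reals, admissible of degree `k`. Functions on
the positive reals are represented by functions on `ℝ`, whose other values are never used. -/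
structure Admissible (k : ℕ) (Ψ : ℝ → ℝ) : Prop where
  pos : ∀ x : ℝ, 0 < x → 0 < Ψ x
  decay : DecayOfDegree k Ψ
  ratio : RatioOfDegree k Ψ

/-- Admissible of every degree `k ≥ 1`. -/
def StrictlyAdmissible (Ψ : ℝ → ℝ) : Prop :=
  ∀ k : ℕ, 1 ≤ k → Admissible k Ψ

/-- `Ψ_j(x) = Ψ(x ^ (1 / j)) x ^ ((j - 1) / j)`, for `j ≥ 1`. -/
def Psi (Ψ : ℝ → ℝ) (j : ℕ) : ℝ → ℝ :=
  fun x => Ψ (x ^ (1 / (j : ℝ))) * x ^ (((j : ℝ) - 1) / (j : ℝ))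

/-- `f(x) = o(1 / x)` as `x → ∞`. -/
def LittleOInv (f : ℝ → ℝ) : Prop :=
  Asymptotics.IsLittleO Filter.atTop f (fun x : ℝ => x⁻¹)

/-- `f(x) ≥ f(y)` for all large `x ≤ y`. -/
def EventuallyNonincreasing (f : ℝ → ℝ) : Prop :=
  ∃ x₀ : ℝ, 0 < x₀ ∧ AntitoneOn f (Set.Ici x₀)

end

open Filter Asymptotics

/-! Good approximations to `(ζ, …, ζ^j)` come from good approximations `p/q` to `ζ` alone. If the
error is `o(1/Q)`, the integers `P_{i+1} Q - P_i P_1` have absolute value below `1` and vanish, so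
`(Q, P)` is geometric: it equals `N (q^j, p q^(j-1), …, p^j)` with `p, q` coprime
(`exists_eq_powVector`). Conversely, when `|ζ| < 1/2`, passing from `p/q` to its powers multiplies
the error by at most `q^(j-1)` (`abs_pow_mul_sub_le`), exactly the factor in `Psi Ψ j (q^j) = Ψ q *
q^(j-1)`. No constant is lost, so the two problems agree for each `0 < c ≤ 1`, hence so do the exact
orders.

Coprime vectors force `N = 1`. For general vectors `Ψ` is evaluated at `Q^(1/j) ≥ q`, and
monotonicity, supplied by the ratio condition, returns to `q`. Liouville's inequality supplies the
transcendence condition of degree `j`. -/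

/-! ### Growth conditions under the transformation `Psi`. -/

theorem Psi_one (Ψ : ℝ → ℝ) : Psi Ψ 1 = Ψ := by
  funext x; simp [Psi]

theorem Psi_pow (Ψ : ℝ → ℝ) {j : ℕ} (hj : 1 ≤ j) {x : ℝ} (hx : 0 ≤ x) :
    Psi Ψ j (x ^ j) = Ψ x * x ^ (j - 1) := by
  have hj0 : (j : ℝ) ≠ 0 := by positivity
  have h1 : (x ^ j) ^ (1 / (j : ℝ)) = x := by
    rw [← Real.rpow_natCast, ← Real.rpow_mul hx, mul_one_div_cancel hj0, Real.rpow_one]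
  have h2 : (x ^ j) ^ (((j : ℝ) - 1) / j) = x ^ (j - 1) := by
    rw [← Real.rpow_natCast, ← Real.rpow_mul hx, mul_div_cancel₀ _ hj0, ← Real.rpow_natCast,
      Nat.cast_sub hj, Nat.cast_one]
  rw [Psi, h1, h2]

theorem Psi_pos {Ψ : ℝ → ℝ} (hΨ : ∀ x, 0 < x → 0 < Ψ x) (j : ℕ) :
    ∀ x, 0 < x → 0 < Psi Ψ j x := fun _ hx =>
  mul_pos (hΨ _ (Real.rpow_pos_of_pos hx _)) (Real.rpow_pos_of_pos hx _)

theorem tendsto_root {j : ℕ} (hj : 1 ≤ j) :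
    Tendsto (fun x : ℝ => x ^ (1 / (j : ℝ))) atTop atTop :=
  tendsto_rpow_atTop (by positivity)

theorem DecayOfDegree.mono {Ψ : ℝ → ℝ} {j k : ℕ} (hjk : j ≤ k) (h : DecayOfDegree k Ψ) :
    DecayOfDegree j Ψ := by
  refine IsLittleO.trans_isBigO h (IsBigO.of_bound 1 ?_)
  filter_upwards [eventually_ge_atTop 1] with x hx
  have hjk' : (j : ℝ) ≤ k := by exact_mod_cast hjk
  rw [one_mul, Real.norm_of_nonneg (by positivity), Real.norm_of_nonneg (by positivity)]
  exact Real.rpow_le_rpow_of_exponent_le hx (by linarith)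

/-- The exponents add up exactly: `(-2jk + 1)/j + (j - 1)/j = -2k + 1`. -/
theorem DecayOfDegree.Psi {Ψ : ℝ → ℝ} {j k : ℕ} (hj : 1 ≤ j) (h : DecayOfDegree (j * k) Ψ) :
    DecayOfDegree k (Psi Ψ j) := by
  have hj0 : (j : ℝ) ≠ 0 := by positivity
  have h1 := (IsLittleO.comp_tendsto h (tendsto_root hj)).mul_isBigO
    (isBigO_refl (fun x : ℝ => x ^ (((j : ℝ) - 1) / j)) atTop)
  refine h1.congr' (Eventually.of_forall fun _ => rfl) ?_
  filter_upwards [eventually_gt_atTop 0] with x hx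
  simp only [Function.comp_apply]
  rw [← Real.rpow_mul hx.le, ← Real.rpow_add hx]
  congr 1
  push_cast
  field_simp
  ring

theorem LittleOInv.of_decay {Ψ : ℝ → ℝ} (h : DecayOfDegree 1 Ψ) : LittleOInv Ψ := by
  refine IsLittleO.congr' h (Eventually.of_forall fun _ => rfl) ?_
  filter_upwards with x
  rw [← Real.rpow_neg_one]
  norm_num

theorem RatioOfDegree.mono {Ψ : ℝ → ℝ} {j k : ℕ} (hjk : j ≤ k) (h : RatioOfDegree k Ψ) :
    RatioOfDegree j Ψ := by
  obtain ⟨x₀, h0, h⟩ := h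
  refine ⟨x₀, h0, fun x y hx hxy => le_trans ?_ (h x y hx hxy)⟩
  have hjk' : (j : ℝ) ≤ k := by exact_mod_cast hjk
  exact Real.rpow_le_rpow_of_exponent_le ((one_le_div (h0.trans_le hx)).2 hxy) (by linarith)

/-- The exponent `(jk - 1)/j` splits as `(k - 1) + (j - 1)/j`; the second summand pays for the power
of `x` in `Psi`. -/
theorem RatioOfDegree.Psi {Ψ : ℝ → ℝ} {j k : ℕ} (hj : 1 ≤ j) (h : RatioOfDegree (j * k) Ψ) :
    RatioOfDegree k (Psi Ψ j) := by
  obtain ⟨x₀, h0, h⟩ := h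
  have hj0 : (0 : ℝ) < j := by positivity
  refine ⟨x₀ ^ j, by positivity, fun x y hx hxy => ?_⟩
  have hx0 : 0 < x := (pow_pos h0 j).trans_le hx
  have hy0 : 0 < y := hx0.trans_le hxy
  have hr : x₀ ≤ x ^ (1 / (j : ℝ)) := by
    rw [one_div]
    refine (Real.le_rpow_inv_iff_of_pos h0.le hx0.le hj0).2 ?_
    rwa [Real.rpow_natCast]
  have key := h _ _ hr (Real.rpow_le_rpow hx0.le hxy (by positivity : 0 ≤ 1 / (j : ℝ)))
  have hyx : 0 < y / x := div_pos hy0 hx0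
  have e1 : (y ^ (1 / (j : ℝ)) / x ^ (1 / (j : ℝ))) ^ (((j * k : ℕ) : ℝ) - 1)
      = (y / x) ^ ((k : ℝ) - 1) * (y / x) ^ (((j : ℝ) - 1) / j) := by
    rw [← Real.div_rpow hy0.le hx0.le, ← Real.rpow_mul hyx.le, ← Real.rpow_add hyx]
    congr 1
    push_cast
    field_simp
    ring
  have e2 : _root_.Psi Ψ j x / _root_.Psi Ψ j y = Ψ (x ^ (1 / (j : ℝ))) / Ψ (y ^ (1 / (j : ℝ)))
      / (y / x) ^ (((j : ℝ) - 1) / j) := by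
    rw [Real.div_rpow hy0.le hx0.le]
    simp only [_root_.Psi]
    have := Real.rpow_pos_of_pos hx0 (((j : ℝ) - 1) / j)
    have := Real.rpow_pos_of_pos hy0 (((j : ℝ) - 1) / j)
    field_simp
  rw [e1] at key
  rw [e2]
  exact (le_div_iff₀ (Real.rpow_pos_of_pos hyx _)).2 key

theorem Admissible.mono {Ψ : ℝ → ℝ} {j k : ℕ} (hjk : j ≤ k) (h : Admissible k Ψ) :
    Admissible j Ψ :=
  ⟨h.pos, h.decay.mono hjk, h.ratio.mono hjk⟩

theorem Admissible.Psi {Ψ : ℝ → ℝ} {j k : ℕ} (hj : 1 ≤ j) (h : Admissible (j * k) Ψ) :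
    Admissible k (Psi Ψ j) :=
  ⟨Psi_pos h.pos j, h.decay.Psi hj, h.ratio.Psi hj⟩

theorem Admissible.eventuallyNonincreasing {Ψ : ℝ → ℝ} (h : Admissible 1 Ψ) :
    EventuallyNonincreasing Ψ := by
  obtain ⟨x₀, h0, hr⟩ := h.ratio
  refine ⟨x₀, h0, fun x hx y hy hxy => ?_⟩
  have := hr x y hx hxy
  simp only [Nat.cast_one, sub_self, Real.rpow_zero] at this
  exact (one_le_div (h.pos y (h0.trans_le hy))).1 this

/-! ### Algebraic degree and irrationality -/

theorem NotAlgOfDegLE.mono {j k : ℕ} (hjk : j ≤ k) {ζ : ℝ} (h : ζ ∈ NotAlgOfDegLE k) :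
    ζ ∈ NotAlgOfDegLE j :=
  fun h' => h ⟨h'.1, h'.2.trans hjk⟩

theorem irrational_of_mem_notAlgOfDegLE {k : ℕ} (hk : 1 ≤ k) {ζ : ℝ} (h : ζ ∈ NotAlgOfDegLE k) :
    Irrational ζ := by
  rintro ⟨r, rfl⟩
  refine h ⟨isAlgebraic_algebraMap (A := ℝ) r, ?_⟩
  have : minpoly ℚ (r : ℝ) = Polynomial.X - Polynomial.C r := minpoly.eq_X_sub_C ℝ r
  rw [this, Polynomial.natDegree_X_sub_C]
  exact hk

theorem exists_liouville_bound {ζ : ℝ} (hirr : Irrational ζ) (halg : IsAlgebraic ℚ ζ) :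
    ∃ A : ℝ, 0 < A ∧ ∀ q : ℕ, 1 ≤ q → ∀ p : ℤ,
      1 ≤ (q : ℝ) ^ (minpoly ℚ ζ).natDegree * (|ζ * q - p| * A) := by
  obtain ⟨b, hb, hmap⟩ := IsLocalization.integerNormalization_spec (nonZeroDivisors ℤ)
    (minpoly ℚ ζ)
  have hroot := IsLocalization.integerNormalization_aeval_eq_zero (nonZeroDivisors ℤ)
    (minpoly ℚ ζ) (minpoly.aeval ℚ ζ)
  generalize IsLocalization.integerNormalization (nonZeroDivisors ℤ) (minpoly ℚ ζ) = f
    at hmap hroot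
  have hb0 : b ≠ 0 := nonZeroDivisors.ne_zero hb
  have hf0 : f ≠ 0 := by
    rintro rfl
    rw [Polynomial.map_zero] at hmap
    exact (smul_ne_zero hb0 (minpoly.ne_zero halg.isIntegral)) hmap.symm
  have hdeg : f.natDegree ≤ (minpoly ℚ ζ).natDegree := by
    rw [← Polynomial.natDegree_map_eq_of_injective (algebraMap ℤ ℚ).injective_int f, hmap]
    exact Polynomial.natDegree_smul_le _ _
  obtain ⟨A, hA, h⟩ := Liouville.exists_pos_real_of_irrational_root hirr hf0
    (by rwa [Polynomial.eval_map_algebraMap])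
  refine ⟨A, hA, fun q hq p => ?_⟩
  -- The Liouville lemma writes its denominators as `n + 1`.
  obtain ⟨n, rfl⟩ := Nat.exists_eq_add_of_le' hq
  refine (h p n).trans ?_
  push_cast
  have hn : (1 : ℝ) ≤ n + 1 := by linarith [Nat.cast_nonneg (α := ℝ) n]
  have hdist : |ζ - p / (n + 1)| ≤ |ζ * (n + 1) - p| := by
    have e : ζ * (n + 1) - p = (ζ - p / (n + 1)) * (n + 1) := by field_simp
    rw [e, abs_mul, abs_of_pos (by linarith : (0 : ℝ) < n + 1)]
    exact le_mul_of_one_le_right (abs_nonneg _) hn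
  gcongr

/-- For degree `d ≤ k`, Liouville bounds `|ζ q - p|` below by a multiple of `q^(-d)`, and `d ≤ k ≤
2k - 1` contradicts the decay. -/
theorem notAlgOfDegLE_of_unbounded {ψ : ℝ → ℝ} {k : ℕ} (hk : 1 ≤ k) (hψ : DecayOfDegree k ψ)
    {ζ : ℝ} (hirr : Irrational ζ)
    (h : ∀ M : ℕ, ∃ q : ℕ, M ≤ q ∧ ∃ p : ℤ, |ζ * q - p| ≤ ψ q) : ζ ∈ NotAlgOfDegLE k := by
  rintro ⟨halg, hdeg⟩
  obtain ⟨A, hA, hL⟩ := exists_liouville_bound hirr halg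
  have hev := (IsLittleO.bound hψ (c := 1 / (2 * A)) (by positivity)).and (eventually_ge_atTop 1)
  obtain ⟨M, hM⟩ := (tendsto_natCast_atTop_atTop (R := ℝ)).eventually hev |>.exists_forall_of_atTop
  obtain ⟨q, hq, p, hp⟩ := h M
  obtain ⟨h1, h2⟩ := hM q hq
  have hk' : (1 : ℝ) ≤ k := by exact_mod_cast hk
  have hq0 : (0 : ℝ) < q := by linarith
  have h3 := hL q (by exact_mod_cast h2) p
  have h4 : (q : ℝ) ^ (minpoly ℚ ζ).natDegree * (q : ℝ) ^ (-2 * (k : ℝ) + 1) ≤ 1 := by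
    rw [← Real.rpow_natCast, ← Real.rpow_add hq0]
    refine Real.rpow_le_one_of_one_le_of_nonpos h2 ?_
    have : ((minpoly ℚ ζ).natDegree : ℝ) ≤ k := by exact_mod_cast hdeg
    linarith
  rw [Real.norm_of_nonneg (by positivity : 0 ≤ (q : ℝ) ^ (-2 * (k : ℝ) + 1))] at h1
  have h5 : |ζ * q - p| * A ≤ (q : ℝ) ^ (-2 * (k : ℝ) + 1) / 2 := by
    have := mul_le_mul_of_nonneg_right (hp.trans ((le_abs_self _).trans h1)) hA.le
    refine this.trans (le_of_eq ?_)
    field_simp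
  have h6 := mul_le_mul_of_nonneg_left h5
    (by positivity : 0 ≤ (q : ℝ) ^ (minpoly ℚ ζ).natDegree)
  linarith

/-! ### Infinite sets of approximating vectors -/

theorem infinite_iff_unbounded {k : ℕ} {ψ : ℝ → ℝ} {ζ : ℝ} {S : Set (ℕ × (Fin k → ℤ))}
    (hS : S ⊆ approxVectors k ψ ζ) : S.Infinite ↔ ∀ M : ℕ, ∃ v ∈ S, M ≤ v.1 := by
  constructor
  · intro hinf M
    by_contra! hM
    refine hinf (Set.Finite.subset (s := ⋃ q ∈ Finset.range M, ({q} : Set ℕ) ×ˢ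
      Set.pi Set.univ fun i : Fin k =>
        Set.Icc ⌈ζ ^ ((i : ℕ) + 1) * q - ψ q⌉ ⌊ζ ^ ((i : ℕ) + 1) * q + ψ q⌋) ?_ ?_)
    · exact (Finset.range M).finite_toSet.biUnion fun q _ =>
        (Set.finite_singleton q).prod (Set.Finite.pi fun i => Set.finite_Icc _ _)
    · intro v hv
      simp only [Set.mem_iUnion]
      refine ⟨v.1, Finset.mem_range.2 (hM v hv), rfl, fun i _ => ?_⟩
      have := abs_le.1 ((hS hv).2 i)
      exact ⟨Int.ceil_le.2 (by linarith), Int.le_floor.2 (by linarith)⟩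
  · intro h hfin
    obtain ⟨B, hB⟩ := (hfin.image Prod.fst).bddAbove
    obtain ⟨v, hv, hle⟩ := h (B + 1)
    have := hB ⟨v, hv, rfl⟩
    omega

/-- A large `Q = N q^j` might come from a large `N`; this bound rules out small `q`. -/
theorem exists_dist_lower_bound {ζ : ℝ} (hirr : Irrational ζ) (M : ℕ) :
    ∃ δ : ℝ, 0 < δ ∧ ∀ q : ℕ, 1 ≤ q → q < M → ∀ p : ℤ, δ ≤ |ζ * q - p| := by
  induction M with
  | zero => exact ⟨1, one_pos, fun q _ h => absurd h (Nat.not_lt_zero q)⟩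
  | succ M ih =>
    obtain ⟨δ, hδ, h⟩ := ih
    rcases Nat.eq_zero_or_pos M with rfl | hM
    · exact ⟨1, one_pos, fun q h1 h2 => by omega⟩
    refine ⟨min δ |ζ * M - round (ζ * M)|, lt_min hδ (abs_pos.2 fun h0 => ?_), ?_⟩
    · exact (hirr.mul_natCast hM.ne').ne_int _ (sub_eq_zero.1 h0)
    · intro q h1 h2 p
      rcases (Nat.lt_succ_iff_lt_or_eq.1 h2) with h3 | rfl
      · exact (min_le_left _ _).trans (h q h1 h3 p)
      · exact (min_le_right _ _).trans (round_le _ _)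

/-! ### Powers of rational approximations -/

/-- The bound `1/2` makes the constant `1`: the difference of `(n + 1)`-th powers costs a factor `(n
+ 1) (q/2)^n`, and `n + 1 ≤ 2^n`. -/
theorem abs_pow_mul_sub_le {ζ q p : ℝ} {j n : ℕ} (hn : n + 1 ≤ j) (hq : 0 ≤ q)
    (hζ : |ζ| ≤ 1 / 2) (hp : |p| ≤ q / 2) :
    |ζ ^ (n + 1) * q ^ j - p ^ (n + 1) * q ^ (j - 1 - n)| ≤ |ζ * q - p| * q ^ (j - 1) := by
  obtain ⟨m, rfl⟩ := Nat.exists_eq_add_of_le hn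
  have e1 : n + 1 + m - 1 - n = m := by omega
  have e2 : n + 1 + m - 1 = n + m := by omega
  rw [e1, e2]
  have e3 : ζ ^ (n + 1) * q ^ (n + 1 + m) - p ^ (n + 1) * q ^ m
      = q ^ m * ((ζ * q) ^ (n + 1) - p ^ (n + 1)) := by ring
  have hζq : |ζ * q| ≤ q / 2 := by
    rw [abs_mul, abs_of_nonneg hq]
    nlinarith
  rw [e3, abs_mul, abs_of_nonneg (pow_nonneg hq m)]
  have h1 := abs_pow_sub_pow_le (ζ * q) p (n + 1)
  have h2 : max |ζ * q| |p| ^ (n + 1 - 1) ≤ (q / 2) ^ n := by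
    rw [Nat.add_sub_cancel]
    exact pow_le_pow_left₀ (le_max_of_le_left (abs_nonneg _)) (max_le hζq hp) n
  have h3 : ((n + 1 : ℕ) : ℝ) * (q / 2) ^ n ≤ q ^ n := by
    have : ((n + 1 : ℕ) : ℝ) ≤ 2 ^ n := by exact_mod_cast Nat.lt_two_pow_self (n := n)
    rw [div_pow, mul_div_assoc', div_le_iff₀ (by positivity), mul_comm]
    exact mul_le_mul_of_nonneg_left this (by positivity)
  calc q ^ m * |(ζ * q) ^ (n + 1) - p ^ (n + 1)|
      ≤ q ^ m * (|ζ * q - p| * q ^ n) := by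
        refine mul_le_mul_of_nonneg_left (h1.trans ?_) (by positivity)
        rw [mul_assoc]
        refine mul_le_mul_of_nonneg_left (le_trans ?_ h3) (abs_nonneg _)
        exact mul_le_mul_of_nonneg_left h2 (by positivity)
    _ = |ζ * q - p| * q ^ (n + m) := by ring

/-- The vector `N * (q ^ j, p * q ^ (j - 1), …, p ^ j)`. -/
def powVector (j : ℕ) (N q : ℕ) (p : ℤ) : ℕ × (Fin j → ℤ) :=
  (N * q ^ j, fun i => N * (p ^ ((i : ℕ) + 1) * (q : ℤ) ^ (j - 1 - i)))

theorem isRelPrimeVector_powVector {j : ℕ} (hj : 1 ≤ j) {q : ℕ} {p : ℤ}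
    (h : Nat.Coprime q p.natAbs) : IsRelPrimeVector (powVector j 1 q p) := by
  have h1 : (Finset.univ.gcd fun i => ((powVector j 1 q p).2 i).natAbs) ∣ p.natAbs ^ j := by
    have := Finset.gcd_dvd (f := fun i => ((powVector j 1 q p).2 i).natAbs)
      (Finset.mem_univ (⟨j - 1, by omega⟩ : Fin j))
    simpa [powVector, Int.natAbs_mul, Int.natAbs_pow, Nat.sub_add_cancel hj] using this
  have h2 : Nat.Coprime (q ^ j) (p.natAbs ^ j) := Nat.Coprime.pow _ _ h
  have h3 := h2.coprime_dvd_right h1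
  simpa [IsRelPrimeVector, powVector] using h3

theorem eq_one_of_isRelPrimeVector_powVector {j N q : ℕ} {p : ℤ}
    (h : IsRelPrimeVector (powVector j N q p)) : N = 1 := by
  refine Nat.dvd_one.1 ?_
  rw [← h]
  refine Nat.dvd_gcd (dvd_mul_right _ _) (Finset.dvd_gcd fun i _ => ?_)
  simp [powVector, Int.natAbs_mul]

theorem eventually_powVector_mem_approxVectors {Ψ : ℝ → ℝ} (hd : LittleOInv Ψ) {j : ℕ}
    (hj : 1 ≤ j) {ζ c : ℝ} (hζ : |ζ| < 1 / 2) (hc : 0 < c) (hc1 : c ≤ 1)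
    (hpos : ∀ x, 0 < x → 0 < Ψ x) :
    ∀ᶠ q : ℕ in atTop, ∀ p : ℤ, |ζ * q - p| ≤ c * Ψ q →
      powVector j 1 q p ∈ approxVectors j (fun x => c * Psi Ψ j x) ζ := by
  have e1 := (IsLittleO.bound hd (c := 1) one_pos).and
    -- This threshold gives `q (1/2 - |ζ|) ≥ 1`, so an error of at most `1` leaves `|p| ≤ q/2`.
    ((eventually_ge_atTop 1).and (eventually_ge_atTop (1 / (1 / 2 - |ζ|))))
  filter_upwards [(tendsto_natCast_atTop_atTop (R := ℝ)).eventually e1] with q hq p hp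
  obtain ⟨h1, h2, h3⟩ := hq
  have hq0 : (0 : ℝ) < q := by linarith
  have hΨ : Ψ q ≤ 1 := by
    refine (le_abs_self _).trans (h1.trans ?_)
    rw [one_mul, Real.norm_of_nonneg (by positivity)]
    exact inv_le_one_of_one_le₀ h2
  have hΨ0 := hpos q hq0
  rw [div_le_iff₀ (by linarith)] at h3
  have hpq : |(p : ℝ)| ≤ q / 2 := by
    have t1 : |(p : ℝ)| ≤ |ζ * q| + |ζ * q - p| := by
      have := abs_sub (ζ * q) (ζ * q - p)
      simpa using this
    rw [abs_mul, abs_of_pos hq0] at t1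
    nlinarith
  refine ⟨?_, fun i => ?_⟩
  · have : 1 ≤ q := by exact_mod_cast h2
    simpa [powVector] using Nat.one_le_pow _ _ this
  · have hi := abs_pow_mul_sub_le (j := j) (n := i) (ζ := ζ) (by omega) hq0.le hζ.le hpq
    simp only [powVector, Nat.cast_one, one_mul, Nat.cast_pow, Int.cast_mul, Int.cast_pow,
      Int.cast_natCast]
    rw [Psi_pow Ψ hj hq0.le, ← mul_assoc]
    exact hi.trans (mul_le_mul_of_nonneg_right hp (by positivity))

theorem exists_eq_powVector {j : ℕ} (hj : 1 ≤ j) {Q : ℕ} (hQ : 1 ≤ Q) {P : Fin j → ℤ} {ζ ε : ℝ}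
    (hζ : |ζ| < 1 / 2) (hε : ε * Q ≤ 1 / 8)
    (h : ∀ i : Fin j, |ζ ^ ((i : ℕ) + 1) * Q - P i| ≤ ε) :
    ∃ N q : ℕ, ∃ p : ℤ, 1 ≤ N ∧ 1 ≤ q ∧ Nat.Coprime q p.natAbs ∧
      (Q, P) = powVector j N q p := by
  have hQ' : (1 : ℝ) ≤ Q := by exact_mod_cast hQ
  have hε0 : 0 ≤ ε := (abs_nonneg _).trans (h ⟨0, hj⟩)
  have hε1 : ε ≤ 1 / 8 := by nlinarith
  set P₁ := P ⟨0, hj⟩ with hP₁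
  have hP : |ζ * Q - P₁| ≤ ε := by simpa using h ⟨0, hj⟩
  have hP₁Q : |(P₁ : ℝ)| ≤ Q / 2 + 1 := by
    have t1 : |(P₁ : ℝ)| ≤ |ζ * Q| + |ζ * Q - P₁| := by
      simpa using abs_sub (ζ * Q) (ζ * Q - P₁)
    rw [abs_mul, abs_of_pos (by linarith : (0 : ℝ) < Q)] at t1
    nlinarith
  -- The difference is an integer of size at most `Qε + Qε/2 + (Q/2 + 1)ε = 2Qε + ε ≤ 3/8`.
  have step : ∀ (i : ℕ) (hi : i + 1 < j),
      P ⟨i + 1, hi⟩ * Q = P ⟨i, by omega⟩ * P₁ := by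
    intro i hi
    have a1 := h ⟨i + 1, hi⟩
    have a2 := h ⟨i, by omega⟩
    simp only at a1 a2
    set x := P ⟨i + 1, hi⟩
    set y := P ⟨i, by omega⟩
    have hz : |ζ ^ (i + 1)| ≤ 1 / 2 := by
      rw [abs_pow, pow_succ]
      have := pow_le_one₀ (n := i) (abs_nonneg ζ) (by linarith)
      nlinarith [abs_nonneg ζ]
    have e : ((x * Q - y * P₁ : ℤ) : ℝ) = -(Q * (ζ ^ (i + 1 + 1) * Q - x))
        + (ζ ^ (i + 1) * (Q * (ζ * Q - P₁)) + P₁ * (ζ ^ (i + 1) * Q - y)) := by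
      push_cast; ring
    have b1 : |(-(Q * (ζ ^ (i + 1 + 1) * Q - x)) : ℝ)| ≤ Q * ε := by
      rw [abs_neg, abs_mul, abs_of_nonneg (by linarith : (0 : ℝ) ≤ Q)]
      exact mul_le_mul_of_nonneg_left a1 (by linarith)
    have b2 : |ζ ^ (i + 1) * (Q * (ζ * Q - P₁))| ≤ 1 / 2 * (Q * ε) := by
      rw [abs_mul, abs_mul, abs_of_nonneg (by linarith : (0 : ℝ) ≤ Q)]
      exact mul_le_mul hz (mul_le_mul_of_nonneg_left hP (by linarith)) (by positivity) (by norm_num)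
    have b3 : |P₁ * (ζ ^ (i + 1) * Q - y)| ≤ (Q / 2 + 1) * ε := by
      rw [abs_mul]
      exact mul_le_mul hP₁Q a2 (abs_nonneg _) (by positivity)
    have b4 : |((x * Q - y * P₁ : ℤ) : ℝ)| < 1 := by
      rw [e]
      refine (abs_add_le _ _).trans_lt ?_
      have := abs_add_le (ζ ^ (i + 1) * (Q * (ζ * Q - P₁))) (P₁ * (ζ ^ (i + 1) * Q - y))
      nlinarith
    rw [← Int.cast_abs] at b4
    have b5 : |x * Q - y * P₁| < 1 := by exact_mod_cast b4
    exact sub_eq_zero.1 (Int.abs_lt_one_iff.1 b5)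
  obtain ⟨d, q, p', hd, hcop, rfl, hp'⟩ : ∃ d q p' : ℕ, 0 < d ∧ Nat.Coprime q p' ∧ Q = q * d ∧
      P₁.natAbs = p' * d := by
    obtain ⟨q, p', h1, h2, h3⟩ := Nat.exists_coprime Q P₁.natAbs
    exact ⟨_, q, p', Nat.gcd_pos_of_pos_left _ hQ, h1, h2, h3⟩
  have hq : 0 < q := Nat.pos_of_ne_zero fun h0 => by simp [h0] at hQ
  obtain ⟨p, hp, hPp⟩ : ∃ p : ℤ, p.natAbs = p' ∧ P₁ = p * d := by
    obtain ⟨p, hp⟩ : (d : ℤ) ∣ P₁ := Int.natCast_dvd.2 ⟨p', by rw [hp', mul_comm]⟩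
    refine ⟨p, ?_, by rw [hp, mul_comm]⟩
    rw [hp, Int.natAbs_mul, Int.natAbs_natCast, mul_comm] at hp'
    exact Nat.eq_of_mul_eq_mul_right hd hp'
  subst hp
  have hdz : (d : ℤ) ≠ 0 := by exact_mod_cast hd.ne'
  have hqz : (q : ℤ) ≠ 0 := by exact_mod_cast hq.ne'
  have main : ∀ (i : ℕ) (hi : i < j), P ⟨i, hi⟩ * (q : ℤ) ^ (i + 1) = q * d * p ^ (i + 1) := by
    intro i
    induction i with
    | zero => intro hi; rw [← hP₁, hPp]; ring
    | succ i ih =>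
      intro hi
      have s := step i hi
      rw [hPp] at s
      push_cast at s
      have s' : P ⟨i + 1, hi⟩ * q = P ⟨i, by omega⟩ * p := by
        apply mul_right_cancel₀ hdz
        linear_combination s
      have := ih (by omega)
      linear_combination (q : ℤ) ^ (i + 1) * s' + p * this
  -- The last coordinate gives `q^j ∣ q d p^j`, and `q` is coprime to `p`.
  obtain ⟨N, hN⟩ : q ^ j ∣ q * d := by
    have m := main (j - 1) (by omega)
    rw [Nat.sub_add_cancel hj] at m
    have hdvd : (q : ℤ) ^ j ∣ ((q * d : ℕ) : ℤ) * p ^ j := ⟨P ⟨j - 1, by omega⟩, by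
      push_cast; rw [← m, mul_comm]⟩
    have hdvd' : q ^ j ∣ q * d * p.natAbs ^ j := by
      have := Int.natAbs_dvd_natAbs.2 hdvd
      simpa [Int.natAbs_mul, Int.natAbs_pow] using this
    exact (Nat.Coprime.pow j j hcop).dvd_of_dvd_mul_right hdvd'
  refine ⟨N, q, p, Nat.pos_of_ne_zero fun h0 => ?_, hq, hcop, ?_⟩
  · rw [h0, mul_zero] at hN
    exact (Nat.mul_pos hq hd).ne' hN
  · refine Prod.ext (by rw [hN, mul_comm]; rfl) (funext fun i => ?_)
    have m := main i i.2
    have hN' : (q : ℤ) * d = q ^ j * N := by exact_mod_cast hN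
    have hsplit : (q : ℤ) ^ j = q ^ (j - 1 - i) * q ^ ((i : ℕ) + 1) := by
      rw [← pow_add]; congr 1; omega
    apply mul_right_cancel₀ (pow_ne_zero ((i : ℕ) + 1) hqz)
    simp only [powVector]
    rw [hN', hsplit] at m
    simp only [Fin.eta] at m
    linear_combination m

/-- Here `x = Q^(1/j)`. The bound on `|ζ q - p|` comes from the first coordinate alone, and `Ψ`
stays at `x` because no monotonicity is assumed. -/
theorem eventually_eq_powVector {Ψ : ℝ → ℝ} {j : ℕ} (hj : 1 ≤ j) (hd : LittleOInv Ψ)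
    (hdj : LittleOInv (Psi Ψ j)) (hpos : ∀ x, 0 < x → 0 < Ψ x) {ζ c : ℝ} (hζ : |ζ| < 1 / 2)
    (hirr : Irrational ζ) (hc : 0 < c) (hc1 : c ≤ 1) (M : ℕ) :
    ∀ᶠ Q : ℕ in atTop, ∀ P : Fin j → ℤ, (Q, P) ∈ approxVectors j (fun x => c * Psi Ψ j x) ζ →
      ∃ N q : ℕ, ∃ p : ℤ, ∃ x : ℝ, M ≤ q ∧ Nat.Coprime q p.natAbs ∧ (Q, P) = powVector j N q p ∧
        (q : ℝ) ≤ x ∧ x ^ j = N * q ^ j ∧ |ζ * q - p| ≤ c * Ψ x := by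
  obtain ⟨δ, hδ, hM⟩ := exists_dist_lower_bound hirr M
  have e1 := IsLittleO.bound hdj (c := 1 / 8) (by norm_num)
  have e2 := IsLittleO.bound hd (c := δ / 2) (by positivity)
  have e3 := (tendsto_root hj).eventually (e2.and (eventually_ge_atTop 1))
  filter_upwards [(tendsto_natCast_atTop_atTop (R := ℝ)).eventually
    (e1.and (e3.and (eventually_ge_atTop 1)))] with Q hQ P hP
  obtain ⟨h1, ⟨h2, h3⟩, h4⟩ := hQ
  have hQ0 : (0 : ℝ) < Q := by linarith
  have hΨj := Psi_pos hpos j Q hQ0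
  have hsmall : c * Psi Ψ j Q * Q ≤ 1 / 8 := by
    rw [Real.norm_of_nonneg hΨj.le, Real.norm_of_nonneg (by positivity), ← div_eq_mul_inv,
      le_div_iff₀ hQ0] at h1
    nlinarith [mul_pos hΨj hQ0]
  obtain ⟨N, q, p, hN, hq, hcop, heq⟩ := exists_eq_powVector hj hP.1 hζ hsmall hP.2
  set x := (Q : ℝ) ^ (1 / (j : ℝ)) with hx
  have hx0 : 0 < x := by linarith
  have hxj : x ^ j = Q := by
    rw [hx, one_div, Real.rpow_inv_natCast_pow hQ0.le (by omega)]
  have hQN : (Q : ℝ) = N * q ^ j := by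
    have : Q = N * q ^ j := congrArg Prod.fst heq
    exact_mod_cast this
  have hN' : (1 : ℝ) ≤ N := by exact_mod_cast hN
  have hq' : (1 : ℝ) ≤ q := by exact_mod_cast hq
  have hqx : (q : ℝ) ≤ x := by
    refine le_of_pow_le_pow_left₀ (by omega : j ≠ 0) hx0.le ?_
    rw [hxj, hQN]
    exact le_mul_of_one_le_left (by positivity) hN'
  have hΨx := hpos x hx0
  have hfirst : N * (q : ℝ) ^ (j - 1) * |ζ * q - p| ≤ c * Ψ x * x ^ (j - 1) := by
    have t := hP.2 ⟨0, hj⟩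
    have hP0 : P ⟨0, hj⟩ = N * (p ^ (0 + 1) * (q : ℤ) ^ (j - 1 - 0)) :=
      congrFun (congrArg Prod.snd heq) ⟨0, hj⟩
    simp only [zero_add, pow_one, hP0, Nat.sub_zero] at t
    rw [← hxj, Psi_pow Ψ hj hx0.le, hxj, hQN] at t
    have e : ζ * (N * (q : ℝ) ^ j) - ((N * (p * (q : ℤ) ^ (j - 1)) : ℤ) : ℝ)
        = N * (q : ℝ) ^ (j - 1) * (ζ * q - p) := by
      push_cast
      rw [← Nat.sub_add_cancel hj, pow_succ, Nat.add_sub_cancel]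
      ring
    rw [e, abs_mul, abs_of_nonneg (by positivity)] at t
    linarith
  -- Both sides of `x^j = N q^j` lose one factor, the left one the larger since `q ≤ x`.
  have hcmp : x ^ (j - 1) ≤ N * (q : ℝ) ^ (j - 1) := by
    have e : x ^ (j - 1) * x = N * (q : ℝ) ^ (j - 1) * q := by
      rw [← pow_succ, Nat.sub_add_cancel hj, hxj, hQN, mul_assoc, ← pow_succ,
        Nat.sub_add_cancel hj]
    refine le_of_mul_le_mul_right ?_ hx0
    rw [e]
    exact mul_le_mul_of_nonneg_left hqx (by positivity)
  have hfin : |ζ * q - p| ≤ c * Ψ x := by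
    have hpos' : 0 < N * (q : ℝ) ^ (j - 1) := by positivity
    refine le_of_mul_le_mul_left ?_ hpos'
    refine hfirst.trans ?_
    rw [mul_comm]
    exact mul_le_mul_of_nonneg_right hcmp (by positivity)
  refine ⟨N, q, p, x, ?_, hcop, heq, hqx, by rw [hxj, hQN], hfin⟩
  -- A small `q` would give `δ ≤ |ζ q - p| ≤ c Ψ x ≤ δ/2`.
  by_contra! hlt
  have t1 := hM q hq hlt p
  have t2 : Ψ x ≤ δ / 2 := by
    refine (le_abs_self _).trans (h2.trans ?_)
    rw [Real.norm_of_nonneg (by positivity)]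
    exact mul_le_of_le_one_right (by positivity) (inv_le_one_of_one_le₀ h3)
  nlinarith

/-! ### Comparison of the two problems -/

theorem mem_approxVectors_one {ψ : ℝ → ℝ} {ζ : ℝ} {v : ℕ × (Fin 1 → ℤ)} :
    v ∈ approxVectors 1 ψ ζ ↔ 1 ≤ v.1 ∧ |ζ * v.1 - v.2 0| ≤ ψ v.1 := by
  simp [approxVectors]

theorem isRelPrimeVector_one {v : ℕ × (Fin 1 → ℤ)} :
    IsRelPrimeVector v ↔ Nat.Coprime v.1 (v.2 0).natAbs := by
  simp [IsRelPrimeVector, Nat.Coprime]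

section Comparison

variable {Ψ : ℝ → ℝ} {j : ℕ} {ζ c : ℝ}

theorem approxSet_iff (hj : 1 ≤ j) (hA : Admissible j Ψ) (hζ : |ζ| < 1 / 2) (hc : 0 < c)
    (hc1 : c ≤ 1) :
    ζ ∈ approxSet j (fun x => c * Psi Ψ j x) ↔ ζ ∈ approxSet 1 (fun x => c * Ψ x) := by
  have hd : LittleOInv Ψ := .of_decay (hA.decay.mono hj)
  have hdj : LittleOInv (Psi Ψ j) := .of_decay (DecayOfDegree.Psi hj (by simpa using hA.decay))
  simp only [approxSet, Set.mem_ofPred_eq, infinite_iff_unbounded subset_rfl]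
  constructor
  · rintro ⟨hn, h⟩
    refine ⟨NotAlgOfDegLE.mono hj hn, fun M => ?_⟩
    obtain ⟨x₀, hx₀, hanti⟩ := (hA.mono hj).eventuallyNonincreasing
    obtain ⟨Q₀, hQ₀⟩ := (eventually_eq_powVector hj hd hdj hA.pos hζ
      -- `M + 1` ensures `q ≥ 1`; `⌈x₀⌉₊` puts `q` where `Ψ` is antitone.
      (irrational_of_mem_notAlgOfDegLE hj hn) hc hc1 (max (M + 1) ⌈x₀⌉₊)).exists_forall_of_atTop
    obtain ⟨⟨Q, P⟩, hv, hQ⟩ := h Q₀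
    obtain ⟨N, q, p, x, hMq, -, -, hqx, -, hle⟩ := hQ₀ Q hQ P hv
    have hx₀q : x₀ ≤ q := Nat.ceil_le.1 ((le_max_right _ _).trans hMq)
    have hMq' := (le_max_left _ _).trans hMq
    refine ⟨(q, fun _ => p), mem_approxVectors_one.2 ⟨by simp only; omega, hle.trans ?_⟩,
      by simp only; omega⟩
    exact mul_le_mul_of_nonneg_left (hanti hx₀q (hx₀q.trans hqx) hqx) hc.le
  · rintro ⟨hn, h⟩
    refine ⟨notAlgOfDegLE_of_unbounded hj (hA.decay.const_mul_left c)
      (irrational_of_mem_notAlgOfDegLE le_rfl hn) fun M => ?_, fun M => ?_⟩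
    · obtain ⟨v, hv, hM⟩ := h M
      exact ⟨v.1, hM, v.2 0, (mem_approxVectors_one.1 hv).2⟩
    · obtain ⟨q₀, hq₀⟩ := (eventually_powVector_mem_approxVectors hd hj hζ hc hc1
        hA.pos).exists_forall_of_atTop
      obtain ⟨v, hv, hM⟩ := h (max M q₀)
      refine ⟨_, hq₀ v.1 ((le_max_right _ _).trans hM) (v.2 0) (mem_approxVectors_one.1 hv).2, ?_⟩
      refine ((le_max_left _ _).trans hM).trans ?_
      simpa [powVector] using Nat.le_self_pow (by omega) v.1

theorem approxSetStar_iff (hj : 1 ≤ j) (hpos : ∀ x, 0 < x → 0 < Ψ x) (hD : DecayOfDegree j Ψ)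
    (hζ : |ζ| < 1 / 2) (hc : 0 < c) (hc1 : c ≤ 1) :
    ζ ∈ approxSetStar j (fun x => c * Psi Ψ j x) ↔ ζ ∈ approxSetStar 1 (fun x => c * Ψ x) := by
  have hd : LittleOInv Ψ := .of_decay (hD.mono hj)
  have hdj : LittleOInv (Psi Ψ j) := .of_decay (DecayOfDegree.Psi hj (by simpa using hD))
  simp only [approxSetStar, Set.mem_ofPred_eq, infinite_iff_unbounded (Set.sep_subset _ _)]
  constructor
  · rintro ⟨hn, h⟩
    refine ⟨NotAlgOfDegLE.mono hj hn, fun M => ?_⟩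
    obtain ⟨Q₀, hQ₀⟩ := (eventually_eq_powVector hj hd hdj hpos hζ
      (irrational_of_mem_notAlgOfDegLE hj hn) hc hc1 (M + 1)).exists_forall_of_atTop
    obtain ⟨⟨Q, P⟩, ⟨hv, hrel⟩, hQ⟩ := h Q₀
    obtain ⟨N, q, p, x, hMq, hcop, heq, hqx, hxj, hle⟩ := hQ₀ Q hQ P hv
    rw [heq] at hrel
    obtain rfl := eq_one_of_isRelPrimeVector_powVector hrel
    rw [Nat.cast_one, one_mul] at hxj
    -- With `N = 1` the argument of `Ψ` is already `q`, which replaces monotonicity.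
    have hxq : x = q := (pow_left_inj₀ ((Nat.cast_nonneg q).trans hqx) (Nat.cast_nonneg q)
      (by omega)).1 hxj
    rw [hxq] at hle
    exact ⟨(q, fun _ => p), ⟨mem_approxVectors_one.2 ⟨by simp only; omega, hle⟩,
      isRelPrimeVector_one.2 hcop⟩, by simp only; omega⟩
  · rintro ⟨hn, h⟩
    refine ⟨notAlgOfDegLE_of_unbounded hj (hD.const_mul_left c)
      (irrational_of_mem_notAlgOfDegLE le_rfl hn) fun M => ?_, fun M => ?_⟩
    · obtain ⟨v, hv, hM⟩ := h M
      exact ⟨v.1, hM, v.2 0, (mem_approxVectors_one.1 hv.1).2⟩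
    · obtain ⟨q₀, hq₀⟩ := (eventually_powVector_mem_approxVectors hd hj hζ hc hc1
        hpos).exists_forall_of_atTop
      obtain ⟨v, hv, hM⟩ := h (max M q₀)
      refine ⟨_, ⟨hq₀ v.1 ((le_max_right _ _).trans hM) (v.2 0) (mem_approxVectors_one.1 hv.1).2,
        isRelPrimeVector_powVector hj (isRelPrimeVector_one.1 hv.2)⟩, ?_⟩
      refine ((le_max_left _ _).trans hM).trans ?_
      simpa [powVector] using Nat.le_self_pow (by omega) v.1

end Comparison

/-! ### Nonpositive constants and sets of exact order. -/

/-- The union over `c < 1` includes `c ≤ 0`, where the comparison lemmas do not apply; an irrational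
`ζ` admits no vectors there. -/
theorem approxVectors_eq_empty {k : ℕ} (hk : 1 ≤ k) {ψ : ℝ → ℝ} (hψ : ∀ x, 0 < x → 0 < ψ x)
    {ζ c : ℝ} (hirr : Irrational ζ) (hc : c ≤ 0) :
    approxVectors k (fun x => c * ψ x) ζ = ∅ := by
  refine Set.eq_empty_of_forall_notMem fun v hv => ?_
  have hv0 : (0 : ℝ) < v.1 := by exact_mod_cast hv.1
  have h1 := (hv.2 ⟨0, hk⟩).trans (mul_nonpos_of_nonpos_of_nonneg hc (hψ _ hv0).le)
  have h2 := abs_nonpos_iff.1 h1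
  simp only [zero_add, pow_one] at h2
  have hv1 : v.1 ≠ 0 := by have := hv.1; omega
  exact (hirr.mul_natCast hv1).ne_int _ (sub_eq_zero.1 h2)

theorem notMem_approxSet_of_nonpos {k : ℕ} (hk : 1 ≤ k) {ψ : ℝ → ℝ} (hψ : ∀ x, 0 < x → 0 < ψ x)
    {ζ c : ℝ} (hc : c ≤ 0) : ζ ∉ approxSet k (fun x => c * ψ x) := by
  rintro ⟨hn, h⟩
  rw [approxVectors_eq_empty hk hψ (irrational_of_mem_notAlgOfDegLE hk hn) hc] at h
  exact h Set.finite_empty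

theorem notMem_approxSetStar_of_nonpos {k : ℕ} (hk : 1 ≤ k) {ψ : ℝ → ℝ}
    (hψ : ∀ x, 0 < x → 0 < ψ x) {ζ c : ℝ} (hc : c ≤ 0) :
    ζ ∉ approxSetStar k (fun x => c * ψ x) := by
  rintro ⟨hn, h⟩
  refine notMem_approxSet_of_nonpos hk hψ hc ⟨hn, h.mono fun v hv => hv.1⟩

theorem exactSet_inter_eq {Ψ : ℝ → ℝ} {j : ℕ} (hj : 1 ≤ j) (hA : Admissible j Ψ) :
    Set.Ioo (-1 / 2 : ℝ) (1 / 2) ∩ exactSet j (Psi Ψ j) =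
      Set.Ioo (-1 / 2 : ℝ) (1 / 2) ∩ exactSet 1 (Psi Ψ 1) := by
  rw [Psi_one]
  ext ζ
  refine and_congr_right fun hζ => ?_
  have hζ' : |ζ| < 1 / 2 := abs_lt.2 ⟨by linarith [hζ.1], hζ.2⟩
  have h1 := approxSet_iff hj hA hζ' one_pos le_rfl
  simp only [one_mul] at h1
  simp only [exactSet, Set.mem_sdiff, Set.mem_iUnion, not_exists]
  refine and_congr h1 (forall₂_congr fun c hc => not_congr ?_)
  rcases le_or_gt c 0 with h0 | h0
  · exact iff_of_false (notMem_approxSet_of_nonpos hj (Psi_pos hA.pos j) h0)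
      (notMem_approxSet_of_nonpos le_rfl hA.pos h0)
  · exact approxSet_iff hj hA hζ' h0 hc.le

theorem exactSetStar_inter_eq {Ψ : ℝ → ℝ} {j : ℕ} (hj : 1 ≤ j) (hpos : ∀ x, 0 < x → 0 < Ψ x)
    (hD : DecayOfDegree j Ψ) :
    Set.Ioo (-1 / 2 : ℝ) (1 / 2) ∩ exactSetStar j (Psi Ψ j) =
      Set.Ioo (-1 / 2 : ℝ) (1 / 2) ∩ exactSetStar 1 (Psi Ψ 1) := by
  rw [Psi_one]
  ext ζ
  refine and_congr_right fun hζ => ?_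
  have hζ' : |ζ| < 1 / 2 := abs_lt.2 ⟨by linarith [hζ.1], hζ.2⟩
  have h1 := approxSetStar_iff hj hpos hD hζ' one_pos le_rfl
  simp only [one_mul] at h1
  simp only [exactSetStar, Set.mem_sdiff, Set.mem_iUnion, not_exists]
  refine and_congr h1 (forall₂_congr fun c hc => not_congr ?_)
  rcases le_or_gt c 0 with h0 | h0
  · exact iff_of_false (notMem_approxSetStar_of_nonpos hj (Psi_pos hpos j) h0)
      (notMem_approxSetStar_of_nonpos le_rfl hpos h0)
  · exact approxSetStar_iff hj hpos hD hζ' h0 hc.le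

theorem theorem6 (Ψ : ℝ → ℝ) :
    -- admissible of degree `k`
    (∀ k : ℕ, 1 ≤ k → Admissible k Ψ →
      ∀ j : ℕ, 1 ≤ j → j ≤ k →
        LittleOInv (Psi Ψ j) ∧ EventuallyNonincreasing (Psi Ψ j) ∧
        Set.Ioo (-1 / 2 : ℝ) (1 / 2) ∩ exactSet j (Psi Ψ j) =
          Set.Ioo (-1 / 2 : ℝ) (1 / 2) ∩ exactSet 1 (Psi Ψ 1)) ∧
    -- strictly admissible
    (StrictlyAdmissible Ψ →
      ∀ j : ℕ, 1 ≤ j →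
        StrictlyAdmissible (Psi Ψ j) ∧
        Set.Ioo (-1 / 2 : ℝ) (1 / 2) ∩ exactSet j (Psi Ψ j) =
          Set.Ioo (-1 / 2 : ℝ) (1 / 2) ∩ exactSet 1 (Psi Ψ 1)) ∧
    -- relatively prime vectors, only the decay condition of degree `k`
    (∀ k : ℕ, 1 ≤ k → (∀ x : ℝ, 0 < x → 0 < Ψ x) → DecayOfDegree k Ψ →
      ∀ j : ℕ, 1 ≤ j → j ≤ k →
        LittleOInv (Psi Ψ j) ∧
        Set.Ioo (-1 / 2 : ℝ) (1 / 2) ∩ exactSetStar j (Psi Ψ j) =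
          Set.Ioo (-1 / 2 : ℝ) (1 / 2) ∩ exactSetStar 1 (Psi Ψ 1)) ∧
    -- relatively prime vectors, the decay condition of every degree
    ((∀ x : ℝ, 0 < x → 0 < Ψ x) → (∀ k : ℕ, 1 ≤ k → DecayOfDegree k Ψ) →
      ∀ j : ℕ, 1 ≤ j →
        (∀ k : ℕ, 1 ≤ k → DecayOfDegree k (Psi Ψ j)) ∧
        Set.Ioo (-1 / 2 : ℝ) (1 / 2) ∩ exactSetStar j (Psi Ψ j) =
          Set.Ioo (-1 / 2 : ℝ) (1 / 2) ∩ exactSetStar 1 (Psi Ψ 1)) := by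
  refine ⟨fun k _ hA j hj hjk => ?_, fun hA j hj => ?_, fun k _ hpos hD j hj hjk => ?_,
    fun hpos hD j hj => ?_⟩
  · have hj1 : Admissible 1 (Psi Ψ j) := Admissible.Psi hj (by simpa using hA.mono hjk)
    exact ⟨.of_decay hj1.decay, hj1.eventuallyNonincreasing, exactSet_inter_eq hj (hA.mono hjk)⟩
  · exact ⟨fun k hk => Admissible.Psi hj (hA _ (Nat.mul_pos hj hk)), exactSet_inter_eq hj (hA j hj)⟩
  · exact ⟨.of_decay (DecayOfDegree.Psi hj (by simpa using hD.mono hjk)),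
      exactSetStar_inter_eq hj hpos (hD.mono hjk)⟩
  · exact ⟨fun k hk => DecayOfDegree.Psi hj (hD _ (Nat.mul_pos hj hk)),
      exactSetStar_inter_eq hj hpos (hD j hj)⟩
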